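/- Let $F=\mathbb F_q$ be a finite field with $q$ elements, let $m\ge 1$, and let $L$ be a finite-dimensional Lie algebra over $\mathbb F_q$, with centre $Z(L)$ and derived subalgebra $L'=[L,L]$, such that - $L$ is nilpotent of nilpotency class exactly $3$; - $L$ is stem, i.e. $Z(L)\subseteq L'$; - $L$ has breadth type $(0,2m)$, i.e. the set of breadths $\{\dim_{\mathbb F_q} L/C_L(x) : x\in L\}$ is exactly $\{0,2m\}$, where $C_L(x)=\{y\in L : [x,y]=0\}$. Let $\mathrm U_3(q^m)$ be the $\mathbb F_q$-Lie algebra of strictly upper triangular $3\times 3$ matrices with entries in $\mathbb F_{q^m}$, under the commutator bracket. Then $$L/Z(L)\;\cong\;\mathrm U_3(q^m)\quad\text{as } \mathbb F_q\text{-Lie algebras.}$$ Moreover, $\overline L=L/Z(L)$ is nilpotent of class exactly $2$, it is a Camina Lie algebra (that is, $[x,\overline L]=\overline L'$ for every $x\in\overline L\setminus\overline L'$), $\dim_{\mathbb F_q}\overline L=3m$, and the centralizer in $\overline L$ of every non-central element of $\overline L$ is abelian. -/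

import Mathlib

namespace NilLie

section Basic

variable (F : Type*) [Field F] (L : Type*) [LieRing L] [LieAlgebra F L]

/-- The centralizer `C_L(x) = {y | [x, y] = 0}`, as a Lie subalgebra of `L`. -/
def centralizer (x : L) : LieSubalgebra F L where
  carrier := {y | ⁅x, y⁆ = 0}
  zero_mem' := lie_zero x
  add_mem' {a b} ha hb := by
    change ⁅x, a⁆ = 0 at ha
    change ⁅x, b⁆ = 0 at hb
    change ⁅x, a + b⁆ = 0
    rw [lie_add, ha, hb, add_zero]
  smul_mem' c a ha := by
    change ⁅x, a⁆ = 0 at ha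
    change ⁅x, c • a⁆ = 0
    rw [lie_smul, ha, smul_zero]
  lie_mem' {a b} ha hb := by
    change ⁅x, a⁆ = 0 at ha
    change ⁅x, b⁆ = 0 at hb
    change ⁅x, ⁅a, b⁆⁆ = 0
    rw [leibniz_lie, ha, hb, zero_lie, lie_zero, add_zero]

/-- The breadth of `x`: the codimension of its centralizer. -/
noncomputable def breadth (x : L) : ℕ :=
  Module.finrank F (L ⧸ (centralizer F L x).toSubmodule)

/-- `L` has breadth type `(n₀, n₁, …, n_r)`: these are exactly the distinct breadths of the
elements of `L`, listed in increasing order. -/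
def HasBreadthType (l : List ℕ) : Prop :=
  l.Pairwise (· < ·) ∧ ∀ n : ℕ, n ∈ l ↔ ∃ x : L, breadth F L x = n

/-- The derived subalgebra `L' = [L, L]`, as an ideal. -/
def derived : LieIdeal F L := ⁅(⊤ : LieIdeal F L), (⊤ : LieIdeal F L)⁆

/-- `L` is stem: `Z(L) ≤ L'`. -/
def IsStem : Prop := LieAlgebra.center F L ≤ derived F L

/-- `L` is `c`-step nilpotent: nilpotent, of nilpotency class exactly `c`. -/
def IsStepNilpotent (L : Type*) [LieRing L] (c : ℕ) : Prop :=
  LieRing.IsNilpotent L ∧ LieModule.nilpotencyLength L L = c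

/-- `L` is a Camina Lie algebra: `[x, L] = L'` for every `x ∈ L \ L'`. -/
def IsCamina : Prop :=
  ∀ x : L, x ∉ derived F L → {z : L | ∃ y : L, ⁅x, y⁆ = z} = (derived F L : Set L)

end Basic

section Matrices

attribute [local instance 100] LieRing.ofAssociativeRing

/-- The `F`-Lie algebra of strictly upper triangular `n × n` matrices with entries in an
extension field `K` of `F`, under the commutator bracket. -/
def strictUpper (F : Type*) [Field F] (n : ℕ) (K : Type*) [Field K] [Algebra F K] :
    LieSubalgebra F (Matrix (Fin n) (Fin n) K) where
  carrier := {A | ∀ i j : Fin n, j ≤ i → A i j = 0}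
  zero_mem' _ _ _ := rfl
  add_mem' {A B} hA hB i j hij := by
    rw [Matrix.add_apply, hA i j hij, hB i j hij, add_zero]
  smul_mem' c A hA i j hij := by
    rw [Matrix.smul_apply, hA i j hij, smul_zero]
  lie_mem' {A B} hA hB i j hij := by
    have key : ∀ M N : Matrix (Fin n) (Fin n) K, (∀ i j : Fin n, j ≤ i → M i j = 0) →
        (∀ i j : Fin n, j ≤ i → N i j = 0) → (M * N) i j = 0 := by
      intro M N hM hN
      rw [Matrix.mul_apply]
      refine Finset.sum_eq_zero fun k _ => ?_
      rcases le_total k i with h | h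
      · rw [hM i k h, zero_mul]
      · rw [hN k j (hij.trans h), mul_zero]
    rw [Ring.lie_def, Matrix.sub_apply, key A B hA hB, key B A hB hA, sub_zero]

end Matrices

end NilLie

namespace NilLie

open Module LieAlgebra

/-! Write Z, Z₂ and D for the centre, second centre and derived algebra of L, C(x) for the
centralizer, M(x) for the elements commuting with x modulo Z. The breadth condition says that every
noncentral C(x) has one dimension s.

Dimension counts based on the Jacobi identity give C([u,v]) = M(u) ∩ M(v), then C([u,v]) = Z₂, for
every noncentral [u,v] (`cent_lie_eq_center₂`). Hence an x outside Z₂ centralizes only Z inside D,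
so M(x) is abelian modulo Z. Further counting shows that ad x maps L onto D modulo Z
(`finrank_centMod`, `exists_lie_sub_mem_center`), and Z₂ = D (`center₂_eq_derived`). So L/Z is
Camina of class 2 with abelian centralizers, and the dimensions follow.

In L/Z fix noncommuting x, y. Sections of ad x and ad y turn the bracket into a product on W = D/Z
with unit [x,y]; abelian centralizers make it commutative, associative and free of zero divisors.
Thus W is a field with q^m elements, and the sections are matrix coordinates
(`nonempty_equiv_strictUpper`). -/

theorem finrank_map_add_finrank_inf_ker {F V W : Type*} [Field F] [AddCommGroup V] [Module F V]
    [AddCommGroup W] [Module F W] [FiniteDimensional F V] (f : V →ₗ[F] W) (p : Submodule F V) :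
    finrank F (p.map f) + finrank F (p ⊓ LinearMap.ker f : Submodule F V) = finrank F p := by
  have h := LinearMap.finrank_range_add_finrank_ker (f.domRestrict p)
  rw [LinearMap.range_domRestrict, LinearMap.ker_domRestrict] at h
  rw [← h, ← Submodule.finrank_map_subtype_eq p (Submodule.comap p.subtype (LinearMap.ker f)),
    Submodule.map_comap_subtype]

/-! ### Centralizers, centralizers modulo the centre, and the second centre -/

section Lie

variable {F L : Type*} [Field F] [LieRing L] [LieAlgebra F L]

theorem mem_center_iff {z : L} : z ∈ center F L ↔ ∀ x : L, ⁅x, z⁆ = 0 :=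
  LieModule.mem_maxTrivSubmodule F L L z

theorem mem_center_iff' {z : L} : z ∈ center F L ↔ ∀ x : L, ⁅z, x⁆ = 0 := by
  rw [mem_center_iff]
  refine forall_congr' fun x => ?_
  rw [← lie_skew, neg_eq_zero]

theorem lie_mem_center_comm {x y : L} : ⁅x, y⁆ ∈ center F L ↔ ⁅y, x⁆ ∈ center F L := by
  rw [← lie_skew, neg_mem_iff]

theorem lie_eq_zero_comm {x y : L} : ⁅x, y⁆ = 0 ↔ ⁅y, x⁆ = 0 := by
  rw [← lie_skew, neg_eq_zero]

variable (F) in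
/-- The centralizer of `x`, as a subspace. -/
abbrev cent (x : L) : Submodule F L := (centralizer F L x).toSubmodule

theorem mem_cent {x y : L} : y ∈ cent F x ↔ ⁅x, y⁆ = 0 := Iff.rfl

theorem cent_lie_comm (x y : L) : cent F ⁅x, y⁆ = cent F ⁅y, x⁆ := by
  ext z
  rw [mem_cent, mem_cent, ← lie_skew x y, neg_lie, neg_eq_zero]

theorem cent_eq_ker (x : L) : cent F x = LinearMap.ker (ad F L x) := by
  ext y
  rw [mem_cent, LinearMap.mem_ker, ad_apply]

variable (F) in
/-- The elements commuting with `x` modulo the centre. -/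
def centMod (x : L) : Submodule F L := (center F L).toSubmodule.comap (ad F L x : L →ₗ[F] L)

theorem mem_centMod {x y : L} : y ∈ centMod F x ↔ ⁅x, y⁆ ∈ center F L := Iff.rfl

theorem mem_centMod_comm {x y : L} : y ∈ centMod F x ↔ x ∈ centMod F y :=
  lie_mem_center_comm (F := F)

variable (F L) in
/-- The second term of the upper central series. -/
def center₂ : Submodule F L := ⨅ x : L, centMod F x

theorem mem_center₂ {z : L} : z ∈ center₂ F L ↔ ∀ x : L, ⁅x, z⁆ ∈ center F L := by
  simp [center₂, mem_centMod]

theorem mem_center₂' {z : L} : z ∈ center₂ F L ↔ ∀ x : L, ⁅z, x⁆ ∈ center F L := by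
  rw [mem_center₂]
  exact forall_congr' fun x => lie_mem_center_comm

theorem center_le_center₂ : (center F L).toSubmodule ≤ center₂ F L := by
  intro z hz
  rw [mem_center₂]
  intro x
  rw [mem_center_iff.1 hz x]
  exact zero_mem _

theorem center_le_cent (x : L) : (center F L).toSubmodule ≤ cent F x :=
  fun _ hz => mem_center_iff.1 hz x

theorem cent_le_centMod (x : L) : cent F x ≤ centMod F x := by
  intro y hy
  rw [mem_centMod, mem_cent.1 hy]
  exact zero_mem _

theorem center₂_le_centMod (x : L) : center₂ F L ≤ centMod F x := iInf_le _ x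

theorem lie_mem_derived (x y : L) : ⁅x, y⁆ ∈ derived F L :=
  LieSubmodule.lie_mem_lie (LieSubmodule.mem_top x) (LieSubmodule.mem_top y)

theorem derived_induction {p : Submodule F L} (h : ∀ x y : L, ⁅x, y⁆ ∈ p) :
    (derived F L).toSubmodule ≤ p := by
  rw [derived, LieSubmodule.lieIdeal_oper_eq_linear_span', Submodule.span_le]
  rintro _ ⟨x, -, y, -, rfl⟩
  exact h x y

/-- Jacobi: [x,y] and [x,z] are central, so both terms of the expansion vanish. -/
theorem lie_lie_eq_zero_of_mem_centMod {x y z : L} (hy : y ∈ centMod F x) (hz : z ∈ centMod F x) :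
    ⁅x, ⁅y, z⁆⁆ = 0 := by
  rw [leibniz_lie, mem_center_iff'.1 (mem_centMod.1 hy), mem_center_iff.1 (mem_centMod.1 hz),
    add_zero]

theorem derived_le_cent_of_mem_center₂ {z : L} (hz : z ∈ center₂ F L) :
    (derived F L).toSubmodule ≤ cent F z :=
  derived_induction fun x y => lie_lie_eq_zero_of_mem_centMod (F := F) (mem_center₂'.1 hz x)
    (mem_center₂'.1 hz y)

theorem derived_le_center₂ (h3 : ∀ w x y z : L, ⁅w, ⁅x, ⁅y, z⁆⁆⁆ = 0) :
    (derived F L).toSubmodule ≤ center₂ F L :=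
  derived_induction fun y z => mem_center₂.2 fun x => mem_center_iff.2 fun w => h3 w x y z

theorem center₂_le_cent (a : L) (ha : a ∈ derived F L) : center₂ F L ≤ cent F a :=
  fun _ hz => lie_eq_zero_comm.1 (derived_le_cent_of_mem_center₂ hz ha)

theorem range_mkQ_comp_ad_le (x : L) :
    LinearMap.range ((center F L).toSubmodule.mkQ ∘ₗ (ad F L x : L →ₗ[F] L)) ≤
      (derived F L).toSubmodule.map (center F L).toSubmodule.mkQ := by
  rintro _ ⟨l, rfl⟩
  exact ⟨_, lie_mem_derived x l, rfl⟩

variable [FiniteDimensional F L]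

theorem finrank_map_ad_add (x : L) (p : Submodule F L) :
    finrank F (p.map (ad F L x : L →ₗ[F] L)) + finrank F (p ⊓ cent F x : Submodule F L) =
      finrank F p := by
  rw [cent_eq_ker]
  exact finrank_map_add_finrank_inf_ker _ p

variable {s : ℕ}

/-- In an algebra of class three with only one breadth of non-central elements, the
centralizer of a non-central commutator is small. -/
theorem map_center₂_and_cent_lie_le (h3 : ∀ w x y z : L, ⁅w, ⁅x, ⁅y, z⁆⁆⁆ = 0)
    (hs : ∀ x : L, x ∉ center F L → finrank F (cent F x) = s) {x l : L}
    (hxl : ⁅x, l⁆ ∉ center F L) :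
    (center₂ F L).map (ad F L x : L →ₗ[F] L) =
      (derived F L).toSubmodule.map (ad F L x : L →ₗ[F] L) ∧
    cent F ⁅x, l⁆ ≤ center₂ F L ⊔ cent F x := by
  set y := ⁅x, l⁆ with hy
  have hx : x ∉ center F L := by
    intro h
    rw [hy, mem_center_iff'.1 h] at hxl
    exact hxl (zero_mem _)
  have hZy : center₂ F L ≤ cent F y := center₂_le_cent y (lie_mem_derived x l)
  have hDA : (derived F L).toSubmodule.map (ad F L x : L →ₗ[F] L) ≤
      (center₂ F L).map (ad F L x : L →ₗ[F] L) := Submodule.map_mono (derived_le_center₂ h3)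
  -- For c in C(x), Jacobi gives [[x,l],c] = [x,[l,c]].
  have hmap : (cent F x).map (ad F L y : L →ₗ[F] L) ≤
      (derived F L).toSubmodule.map (ad F L x : L →ₗ[F] L) := by
    rintro _ ⟨c, hc, rfl⟩
    refine ⟨⁅l, c⁆, lie_mem_derived l c, ?_⟩
    change ⁅x, ⁅l, c⁆⁆ = ⁅y, c⁆
    rw [leibniz_lie, mem_cent.1 hc, lie_zero, add_zero]
  have e1 := finrank_map_ad_add y (cent F x)
  have e2 := finrank_map_ad_add x (center₂ F L)
  have e3 := Submodule.finrank_sup_add_finrank_inf_eq (center₂ F L) (cent F x ⊓ cent F y)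
  have e4 : center₂ F L ⊓ (cent F x ⊓ cent F y) = center₂ F L ⊓ cent F x := by
    rw [inf_comm (cent F x), ← inf_assoc, inf_eq_left.2 hZy]
  have hsup : center₂ F L ⊔ cent F x ⊓ cent F y ≤ cent F y := sup_le hZy inf_le_right
  have i1 := Submodule.finrank_mono hmap
  have i2 := Submodule.finrank_mono hDA
  have i3 := Submodule.finrank_mono hsup
  rw [e4] at e3
  rw [hs x hx] at e1
  rw [hs y hxl] at i3
  -- Z₂ + (C(x) ∩ C(y)) lies in C(y) and has dimension s + dim [x,Z₂] − dim [y,C(x)] ≥ s + dim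
  -- [x,Z₂] − dim [x,D] ≥ s. As dim C(y) = s, every inequality is an equality.
  constructor
  · exact (Submodule.eq_of_le_of_finrank_le hDA (by omega)).symm
  · rw [← Submodule.eq_of_le_of_finrank_le hsup (by rw [hs y hxl]; omega)]
    exact sup_le_sup_left inf_le_left _

/-- The centralizer of a non-central commutator `[u, v]` consists of the elements that commute
with both `u` and `v` modulo the centre. -/
theorem cent_lie_eq (h3 : ∀ w x y z : L, ⁅w, ⁅x, ⁅y, z⁆⁆⁆ = 0)
    (hs : ∀ x : L, x ∉ center F L → finrank F (cent F x) = s) {u v : L}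
    (huv : ⁅u, v⁆ ∉ center F L) : cent F ⁅u, v⁆ = centMod F u ⊓ centMod F v := by
  have key : ∀ {u v : L}, ⁅u, v⁆ ∉ center F L → cent F ⁅u, v⁆ ≤ centMod F u := fun {u v} h =>
    (map_center₂_and_cent_lie_le h3 hs h).2.trans
      (sup_le (center₂_le_centMod u) (cent_le_centMod u))
  apply le_antisymm
  · refine le_inf (key huv) ?_
    rw [cent_lie_comm]
    exact key (mt lie_mem_center_comm.1 huv)
  · rintro y ⟨hu, hv⟩
    exact lie_eq_zero_comm.1 (lie_lie_eq_zero_of_mem_centMod (mem_centMod_comm.1 hu)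
      (mem_centMod_comm.1 hv))

/-- If x outside Z₂ centralized [u,v], then M(u) and M(v) would lie in M(x). For w outside M(x),
equal dimensions then force C([x,w]) = C([u,v]), which contains x; so x commutes with w modulo Z, a
contradiction. -/
theorem cent_lie_eq_center₂ (h3 : ∀ w x y z : L, ⁅w, ⁅x, ⁅y, z⁆⁆⁆ = 0)
    (hs : ∀ x : L, x ∉ center F L → finrank F (cent F x) = s) {u v : L}
    (huv : ⁅u, v⁆ ∉ center F L) : cent F ⁅u, v⁆ = center₂ F L := by
  refine le_antisymm (fun x hx => ?_) (center₂_le_cent _ (lie_mem_derived u v))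
  by_contra hx2
  have le : ∀ {u v : L}, ⁅u, v⁆ ∉ center F L → x ∈ cent F ⁅u, v⁆ →
      centMod F u ≤ centMod F x := by
    -- Replacing v by v + w changes [u,v] only by a central element, so x lies in M(v + w) as well
    -- as M(v), hence in M(w).
    intro u v huv hx w hw
    by_contra hwx
    have h1 : ⁅u, v + w⁆ ∉ center F L := by
      rw [lie_add]
      exact fun h => huv ((add_mem_cancel_right (mem_centMod.1 hw)).1 h)
    have h2 : x ∈ cent F ⁅u, v + w⁆ := by
      rw [mem_cent, lie_add, add_lie, mem_cent.1 hx, mem_center_iff'.1 (mem_centMod.1 hw), add_zero]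
    rw [cent_lie_eq h3 hs h1] at h2
    rw [cent_lie_eq h3 hs huv] at hx
    have h3 := mem_centMod_comm.1 h2.2
    have h4 := mem_centMod_comm.1 hx.2
    exact hwx ((Submodule.add_mem_iff_right _ h4).1 h3)
  have hu := le huv hx
  have hv : centMod F v ≤ centMod F x := by
    rw [cent_lie_comm] at hx
    exact le (mt lie_mem_center_comm.1 huv) hx
  obtain ⟨w, hw⟩ : ∃ w, ⁅x, w⁆ ∉ center F L := by
    by_contra! h
    exact hx2 (mem_center₂'.2 h)
  have eq : ∀ u : L, centMod F u ≤ centMod F x →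
      centMod F x ⊓ centMod F w = centMod F u ⊓ centMod F w := by
    intro u hu
    have h1 : ⁅u, w⁆ ∉ center F L := fun h => hw (hu h)
    refine (Submodule.eq_of_le_of_finrank_eq (inf_le_inf_right _ hu) ?_).symm
    rw [← cent_lie_eq h3 hs h1, ← cent_lie_eq h3 hs hw, hs _ h1, hs _ hw]
  have hle : centMod F x ⊓ centMod F w ≤ centMod F u ⊓ centMod F v := by
    refine le_inf ?_ ?_
    · rw [eq u hu]; exact inf_le_left
    · rw [eq v hv]; exact inf_le_left
  rw [← cent_lie_eq h3 hs huv, ← cent_lie_eq h3 hs hw] at hle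
  rw [← Submodule.eq_of_le_of_finrank_eq hle (by rw [hs _ huv, hs _ hw]),
    cent_lie_eq h3 hs hw] at hx
  exact hw (mem_centMod_comm.1 hx.2)

end Lie

/-! ### Dimension formulas, surjectivity of ad x modulo the centre, and Z₂ = D -/

section Lie

variable {F L : Type*} [Field F] [LieRing L] [LieAlgebra F L] [FiniteDimensional F L] {s : ℕ}

theorem cent_eq_center₂_of_mem_derived (h3 : ∀ w x y z : L, ⁅w, ⁅x, ⁅y, z⁆⁆⁆ = 0)
    (hs : ∀ x : L, x ∉ center F L → finrank F (cent F x) = s) {a : L}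
    (ha : a ∈ derived F L) (haz : a ∉ center F L) : cent F a = center₂ F L := by
  obtain ⟨u, v, huv⟩ : ∃ u v : L, ⁅u, v⁆ ∉ center F L := by
    by_contra! h
    exact haz (derived_induction (p := (center F L).toSubmodule) h ha)
  refine (Submodule.eq_of_le_of_finrank_eq (center₂_le_cent a ha) ?_).symm
  rw [hs a haz, ← cent_lie_eq_center₂ h3 hs huv, hs _ huv]

theorem mem_center_of_lie_eq_zero (h3 : ∀ w x y z : L, ⁅w, ⁅x, ⁅y, z⁆⁆⁆ = 0)
    (hs : ∀ x : L, x ∉ center F L → finrank F (cent F x) = s) {x a : L}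
    (hx : x ∉ center₂ F L) (ha : a ∈ derived F L) (h : ⁅x, a⁆ = 0) : a ∈ center F L := by
  by_contra haz
  rw [← cent_eq_center₂_of_mem_derived h3 hs ha haz] at hx
  exact hx (lie_eq_zero_comm.1 h)

/-- This is the source of the abelian centralizers in L/Z: x kills [y,z] in D, and outside Z₂ it
kills only Z there. -/
theorem lie_mem_center_of_mem_centMod (h3 : ∀ w x y z : L, ⁅w, ⁅x, ⁅y, z⁆⁆⁆ = 0)
    (hs : ∀ x : L, x ∉ center F L → finrank F (cent F x) = s) {x y z : L}
    (hx : x ∉ center₂ F L) (hy : y ∈ centMod F x) (hz : z ∈ centMod F x) :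
    ⁅y, z⁆ ∈ center F L :=
  mem_center_of_lie_eq_zero h3 hs hx (lie_mem_derived y z) (lie_lie_eq_zero_of_mem_centMod hy hz)

theorem centMod_inf_centMod (h3 : ∀ w x y z : L, ⁅w, ⁅x, ⁅y, z⁆⁆⁆ = 0)
    (hs : ∀ x : L, x ∉ center F L → finrank F (cent F x) = s) {x y : L}
    (hxy : ⁅x, y⁆ ∉ center F L) : centMod F x ⊓ centMod F y = center₂ F L := by
  rw [← cent_lie_eq h3 hs hxy, cent_lie_eq_center₂ h3 hs hxy]

theorem finrank_range_mkQ_comp_ad (x : L) :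
    finrank F (LinearMap.range ((center F L).toSubmodule.mkQ ∘ₗ (ad F L x : L →ₗ[F] L))) +
      finrank F (centMod F x) = finrank F L := by
  have h := LinearMap.finrank_range_add_finrank_ker
    ((center F L).toSubmodule.mkQ ∘ₗ (ad F L x : L →ₗ[F] L))
  rwa [LinearMap.ker_comp, Submodule.ker_mkQ] at h

theorem finrank_map_mkQ_derived (hstem : IsStem F L) :
    finrank F ((derived F L).toSubmodule.map (center F L).toSubmodule.mkQ) +
      finrank F (center F L) = finrank F (derived F L) := by
  have h := finrank_map_add_finrank_inf_ker (center F L).toSubmodule.mkQ (derived F L).toSubmodule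
  rwa [Submodule.ker_mkQ, inf_eq_right.2 (show (center F L).toSubmodule ≤ _ from hstem)] at h

/-- ad x embeds L/M(x) into D/Z. -/
theorem finrank_centMod_add_ge (hstem : IsStem F L) (x : L) :
    finrank F L + finrank F (center F L) ≤ finrank F (centMod F x) + finrank F (derived F L) := by
  have e1 := finrank_range_mkQ_comp_ad (F := F) x
  have e2 := finrank_map_mkQ_derived hstem
  have i := Submodule.finrank_mono (range_mkQ_comp_ad_le (F := F) x)
  omega

/-- M(x) contains Z₂ + C(x), of dimension s + dim [x,Z₂]. Here s = dim Z₂, and [x,Z₂] = [x,D] is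
isomorphic to D/Z. -/
theorem le_finrank_centMod (h3 : ∀ w x y z : L, ⁅w, ⁅x, ⁅y, z⁆⁆⁆ = 0)
    (hs : ∀ x : L, x ∉ center F L → finrank F (cent F x) = s) (hstem : IsStem F L) {x : L}
    (hx : x ∉ center₂ F L) : finrank F (center₂ F L) + finrank F (derived F L) ≤
      finrank F (centMod F x) + finrank F (center F L) := by
  obtain ⟨l, hl⟩ : ∃ l, ⁅x, l⁆ ∉ center F L := by
    by_contra! h
    exact hx (mem_center₂'.2 h)
  have hxz : x ∉ center F L := fun h => hx (center_le_center₂ h)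
  have e1 := finrank_map_ad_add x (center₂ F L)
  have e2 := finrank_map_ad_add x (derived F L).toSubmodule
  have e3 : (derived F L).toSubmodule ⊓ cent F x = (center F L).toSubmodule :=
    le_antisymm (fun a ha => mem_center_of_lie_eq_zero h3 hs hx ha.1 ha.2)
      (le_inf hstem (center_le_cent x))
  have e4 := Submodule.finrank_sup_add_finrank_inf_eq (center₂ F L) (cent F x)
  have e5 : finrank F (center₂ F L) = s := by rw [← cent_lie_eq_center₂ h3 hs hl, hs _ hl]
  have hsup : center₂ F L ⊔ cent F x ≤ centMod F x :=
    sup_le (center₂_le_centMod x) (cent_le_centMod x)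
  have i := Submodule.finrank_mono hsup
  rw [hs x hxz] at e4
  rw [(map_center₂_and_cent_lie_le h3 hs hl).1] at e1
  rw [e3] at e2
  change _ + finrank F (center F L) = finrank F (derived F L) at e2
  omega

/-- For l not commuting with x modulo Z, M(x) ∩ M(l) = Z₂. The lower bounds for M(x) and M(l), with
their sum inside L, meet the bound dim L/M(x) ≤ dim D/Z. -/
theorem finrank_centMod (h3 : ∀ w x y z : L, ⁅w, ⁅x, ⁅y, z⁆⁆⁆ = 0)
    (hs : ∀ x : L, x ∉ center F L → finrank F (cent F x) = s) (hstem : IsStem F L) {x : L}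
    (hx : x ∉ center₂ F L) :
    finrank F (centMod F x) + finrank F (center F L) =
      finrank F (center₂ F L) + finrank F (derived F L) ∧
    finrank F L + 2 * finrank F (center F L) =
      finrank F (center₂ F L) + 2 * finrank F (derived F L) := by
  obtain ⟨l, hl⟩ : ∃ l, ⁅x, l⁆ ∉ center F L := by
    by_contra! h
    exact hx (mem_center₂'.2 h)
  have hl2 : l ∉ center₂ F L := fun h => hl (mem_center₂.1 h x)
  have e := Submodule.finrank_sup_add_finrank_inf_eq (centMod F x) (centMod F l)
  rw [centMod_inf_centMod h3 hs hl] at e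
  have i := Submodule.finrank_le (centMod F x ⊔ centMod F l)
  have i1 := le_finrank_centMod h3 hs hstem hx
  have i2 := le_finrank_centMod h3 hs hstem hl2
  have i3 := finrank_centMod_add_ge hstem x
  have i4 := finrank_centMod_add_ge hstem l
  omega

theorem centMod_sup_centMod (h3 : ∀ w x y z : L, ⁅w, ⁅x, ⁅y, z⁆⁆⁆ = 0)
    (hs : ∀ x : L, x ∉ center F L → finrank F (cent F x) = s) (hstem : IsStem F L) {x y : L}
    (hxy : ⁅x, y⁆ ∉ center F L) : centMod F x ⊔ centMod F y = ⊤ := by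
  have hx2 : x ∉ center₂ F L := fun h => hxy (mem_center₂'.1 h y)
  have hy2 : y ∉ center₂ F L := fun h => hxy (mem_center₂.1 h x)
  have e := Submodule.finrank_sup_add_finrank_inf_eq (centMod F x) (centMod F y)
  rw [centMod_inf_centMod h3 hs hxy] at e
  have i1 := finrank_centMod h3 hs hstem hx2
  have i2 := finrank_centMod h3 hs hstem hy2
  exact Submodule.eq_top_of_finrank_eq (by omega)

theorem exists_lie_sub_mem_center (h3 : ∀ w x y z : L, ⁅w, ⁅x, ⁅y, z⁆⁆⁆ = 0)
    (hs : ∀ x : L, x ∉ center F L → finrank F (cent F x) = s) (hstem : IsStem F L) {x a : L}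
    (hx : x ∉ center₂ F L) (ha : a ∈ derived F L) : ∃ l : L, ⁅x, l⁆ - a ∈ center F L := by
  have e1 := finrank_range_mkQ_comp_ad (F := F) x
  have e2 := finrank_map_mkQ_derived hstem
  have i := finrank_centMod h3 hs hstem hx
  have h := Submodule.eq_of_le_of_finrank_eq (range_mkQ_comp_ad_le (F := F) x) (by omega)
  obtain ⟨l, hl⟩ := h.ge (Submodule.mem_map_of_mem ha)
  exact ⟨l, (Submodule.Quotient.eq _).1 hl⟩

/-- Since L = M(x) + M(y), a preimage under ad x can be moved into M(y) by dropping its M(x) part.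
-/
theorem exists_mem_centMod_lie_sub_mem_center (h3 : ∀ w x y z : L, ⁅w, ⁅x, ⁅y, z⁆⁆⁆ = 0)
    (hs : ∀ x : L, x ∉ center F L → finrank F (cent F x) = s) (hstem : IsStem F L) {x y a : L}
    (hxy : ⁅x, y⁆ ∉ center F L) (ha : a ∈ derived F L) :
    ∃ u ∈ centMod F y, ⁅x, u⁆ - a ∈ center F L := by
  have hx2 : x ∉ center₂ F L := fun h => hxy (mem_center₂'.1 h y)
  obtain ⟨l, hl⟩ := exists_lie_sub_mem_center h3 hs hstem hx2 ha
  have hl2 : l ∈ centMod F x ⊔ centMod F y := by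
    rw [centMod_sup_centMod h3 hs hstem hxy]
    exact Submodule.mem_top
  obtain ⟨v, hv, u, hu, rfl⟩ := Submodule.mem_sup.1 hl2
  refine ⟨u, hu, ?_⟩
  rw [lie_add, add_sub_assoc] at hl
  exact (add_mem_cancel_left (mem_centMod.1 hv)).1 hl

/-- Amounts to [x,D] ∩ [y,D] = 0. Modulo Z write a = [y,u] and b = [x,v] with u in M(x), v in M(y).
Jacobi puts u + v in C([x,y]) = M(x) ∩ M(y), so v lies in Z₂ and b is central; then [x,a] = 0. -/
theorem mem_center_of_lie_eq_lie (h3 : ∀ w x y z : L, ⁅w, ⁅x, ⁅y, z⁆⁆⁆ = 0)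
    (hs : ∀ x : L, x ∉ center F L → finrank F (cent F x) = s) (hstem : IsStem F L)
    {x y a b : L} (hxy : ⁅x, y⁆ ∉ center F L) (ha : a ∈ derived F L) (hb : b ∈ derived F L)
    (hab : ⁅x, a⁆ = ⁅y, b⁆) : a ∈ center F L := by
  have hyx : ⁅y, x⁆ ∉ center F L := mt lie_mem_center_comm.1 hxy
  obtain ⟨u, hu, hua⟩ := exists_mem_centMod_lie_sub_mem_center h3 hs hstem hyx ha
  obtain ⟨v, hv, hvb⟩ := exists_mem_centMod_lie_sub_mem_center h3 hs hstem hxy hb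
  have hxa : ⁅x, a⁆ = ⁅x, ⁅y, u⁆⁆ := by
    rw [← sub_eq_zero, ← neg_eq_zero, neg_sub, ← lie_sub, mem_center_iff.1 hua]
  have hyb : ⁅y, b⁆ = ⁅y, ⁅x, v⁆⁆ := by
    rw [← sub_eq_zero, ← neg_eq_zero, neg_sub, ← lie_sub, mem_center_iff.1 hvb]
  have h1 : ⁅x, ⁅y, u⁆⁆ = ⁅⁅x, y⁆, u⁆ := by
    rw [leibniz_lie, mem_center_iff.1 (mem_centMod.1 hu), add_zero]
  have h2 : ⁅y, ⁅x, v⁆⁆ = -⁅⁅x, y⁆, v⁆ := by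
    rw [leibniz_lie, mem_center_iff.1 (mem_centMod.1 hv), add_zero, ← lie_skew y x, neg_lie]
  have h4 : u + v ∈ cent F ⁅x, y⁆ := by
    rw [mem_cent, lie_add, ← h1, ← hxa, hab, hyb, h2, neg_add_cancel]
  rw [cent_lie_eq h3 hs hxy] at h4
  have h5 : v ∈ centMod F x := (Submodule.add_mem_iff_right _ hu).1 h4.1
  have h6 : v ∈ center₂ F L := by
    rw [← centMod_inf_centMod h3 hs hxy]
    exact ⟨h5, hv⟩
  have h7 : b ∈ center F L := by
    have := sub_mem (mem_center₂.1 h6 x) hvb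
    rwa [sub_sub_cancel] at this
  refine mem_center_of_lie_eq_zero h3 hs (fun h => hxy (mem_center₂'.1 h y)) ha ?_
  rw [hab, mem_center_iff.1 h7]

theorem center₂_eq_derived (h3 : ∀ w x y z : L, ⁅w, ⁅x, ⁅y, z⁆⁆⁆ = 0)
    (hs : ∀ x : L, x ∉ center F L → finrank F (cent F x) = s) (hstem : IsStem F L)
    {x y : L} (hxy : ⁅x, y⁆ ∉ center F L) : center₂ F L = (derived F L).toSubmodule := by
  refine le_antisymm (fun z hz => ?_) (derived_le_center₂ h3)
  have key : ∀ {u v : L}, ⁅u, v⁆ ∉ center F L → ∀ z ∈ center₂ F L,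
      ∃ a ∈ derived F L, ⁅u, a⁆ = ⁅u, z⁆ := fun huv z hz =>
    (map_center₂_and_cent_lie_le h3 hs huv).1.le (Submodule.mem_map_of_mem hz)
  obtain ⟨a, ha, hxa⟩ := key hxy z hz
  -- The difference t = z − a lies in Z₂ and commutes with x; it is shown to commute with
  -- everything.
  suffices z - a ∈ center F L by
    have := add_mem (hstem this) ha
    rwa [sub_add_cancel] at this
  have hxz : ⁅x, z - a⁆ = 0 := by rw [lie_sub, hxa, sub_self]
  have hz' : z - a ∈ center₂ F L := sub_mem hz (derived_le_center₂ h3 ha)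
  generalize z - a = t at hxz hz'
  have h0 : ∀ w : L, ⁅x, w⁆ ∉ center F L → ⁅w, t⁆ = 0 := by
    intro w hw
    have hw' : ⁅w, x⁆ ∉ center F L := mt lie_mem_center_comm.1 hw
    obtain ⟨b, hb, hwb⟩ := key hw' t hz'
    -- Comparing the actions of w and x + w on t gives [x,e] = [w,b − e], so e and b − e are
    -- central, and [w,t] = [w,b] = 0.
    obtain ⟨e, he, hwe⟩ := key (u := x + w) (v := x) (by rwa [add_lie, lie_self, zero_add]) t hz'
    rw [add_lie, add_lie, hxz, zero_add, ← hwb] at hwe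
    have h1 : ⁅x, e⁆ = ⁅w, b - e⁆ := by rw [lie_sub, ← hwe, add_sub_cancel_right]
    have h2 := mem_center_of_lie_eq_lie h3 hs hstem hw he (sub_mem hb he) h1
    have h4 := mem_center_of_lie_eq_lie h3 hs hstem hw' (sub_mem hb he) he h1.symm
    have h5 := add_mem h4 h2
    rw [sub_add_cancel] at h5
    rw [← hwb, mem_center_iff.1 h5]
  rw [mem_center_iff]
  intro w
  by_cases hw : ⁅x, w⁆ ∈ center F L
  -- Neither y nor w + y commutes with x modulo Z, so `h0` applies to both.
  · have h1 := h0 (w + y) (by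
      rw [lie_add]
      exact fun h => hxy ((add_mem_cancel_left hw).1 h))
    rwa [add_lie, h0 y hxy, add_zero] at h1
  · exact h0 w hw

end Lie

/-! ### Finite fields from bilinear products -/

/-- A finite commutative domain is a field, and both sides are splitting fields over F of X^|K| − X.
-/
theorem nonempty_algEquiv_of_natCard_eq {F K R : Type*} [Field F] [Field K] [Algebra F K]
    [CommRing R] [IsDomain R] [Algebra F R] [Finite R] (h : Nat.card K = Nat.card R) :
    Nonempty (K ≃ₐ[F] R) := by
  have hK : Finite K := Nat.finite_of_card_ne_zero (h ▸ Nat.card_pos.ne')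
  let := Fintype.ofFinite K
  let := Fintype.ofFinite R
  let : Field R := (Finite.isField_of_domain R).toField
  rw [Nat.card_eq_fintype_card, Nat.card_eq_fintype_card] at h
  have := FiniteField.isSplittingField_sub K F
  have hR := FiniteField.isSplittingField_sub R F
  rw [← h] at hR
  exact ⟨(Polynomial.IsSplittingField.algEquiv K (Polynomial.X ^ Fintype.card K - Polynomial.X)).trans
    (Polynomial.IsSplittingField.algEquiv R (Polynomial.X ^ Fintype.card K - Polynomial.X)).symm⟩

/-- A finite vector space with a commutative, associative and unital bilinear multiplication
without zero divisors is a copy of the field with the same number of elements. -/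
theorem exists_linearEquiv_mul {F K V : Type*} [Field F] [Field K] [Algebra F K]
    [AddCommGroup V] [Module F V] [Finite V] (μ : V →ₗ[F] V →ₗ[F] V) (c : V) (hc : c ≠ 0)
    (one_mul : ∀ a, μ c a = a) (comm : ∀ a b, μ a b = μ b a)
    (assoc : ∀ a b d, μ (μ a b) d = μ a (μ b d)) (nzd : ∀ a b, μ a b = 0 → a = 0 ∨ b = 0)
    (h : Nat.card K = Nat.card V) :
    ∃ φ : K ≃ₗ[F] V, ∀ s t, φ (s * t) = μ (φ s) (φ t) := by
  let : CommRing V :=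
    { (inferInstance : AddCommGroup V) with
      mul := fun a b => μ a b
      one := c
      one_mul := one_mul
      mul_one := fun a => (comm a c).trans (one_mul a)
      mul_comm := comm
      mul_assoc := assoc
      zero_mul := fun a => LinearMap.map_zero₂ μ a
      mul_zero := fun a => map_zero (μ a)
      left_distrib := fun a b d => map_add (μ a) b d
      right_distrib := fun a b d => LinearMap.map_add₂ μ a b d }
  let : Algebra F V := Algebra.ofModule (fun r a b => LinearMap.map_smul₂ μ r a b)
    (fun r a b => map_smul (μ a) r b)
  have : Nontrivial V := ⟨c, 0, hc⟩
  have : NoZeroDivisors V := ⟨fun {a b} hab => nzd a b hab⟩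
  have : IsDomain V := NoZeroDivisors.to_isDomain V
  obtain ⟨e⟩ := nonempty_algEquiv_of_natCard_eq (F := F) h
  exact ⟨e.toLinearEquiv, fun s t => map_mul e s t⟩

/-! ### Matrix coordinates on a class two algebra -/

section Coordinates

attribute [local instance 100] LieRing.ofAssociativeRing

variable {F M : Type*} [Field F] [LieRing M] [LieAlgebra F M]

theorem exists_section {W : Submodule F M} (hlie : ∀ x y : M, ⁅x, y⁆ ∈ W)
    {x y : M} (hsurj : ∀ w ∈ W, ∃ u, ⁅y, u⁆ = 0 ∧ ⁅x, u⁆ = w) :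
    ∃ σ : W →ₗ[F] M, ∀ w, ⁅x, σ w⁆ = w ∧ ⁅y, σ w⁆ = 0 := by
  let f : cent F y →ₗ[F] W := ((ad F M x : M →ₗ[F] M).codRestrict W (hlie x)).domRestrict _
  have hf : LinearMap.range f = ⊤ := by
    rw [LinearMap.range_eq_top]
    rintro ⟨w, hw⟩
    obtain ⟨u, hu, rfl⟩ := hsurj w hw
    exact ⟨⟨u, hu⟩, rfl⟩
  obtain ⟨g, hg⟩ := f.exists_rightInverse_of_surjective hf
  refine ⟨(cent F y).subtype ∘ₗ g, fun w => ⟨?_, (g w).2⟩⟩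
  exact congrArg Subtype.val (LinearMap.congr_fun hg w)

theorem strictUpper_lie {K : Type*} [Field K] [Algebra F K] (A B : strictUpper F 3 K) :
    (⁅A, B⁆ : strictUpper F 3 K).1 0 1 = 0 ∧ (⁅A, B⁆ : strictUpper F 3 K).1 1 2 = 0 ∧
    (⁅A, B⁆ : strictUpper F 3 K).1 0 2 = A.1 0 1 * B.1 1 2 - B.1 0 1 * A.1 1 2 := by
  have hA := A.2
  have hB := B.2
  rw [LieSubalgebra.coe_bracket, Ring.lie_def]
  simp only [Matrix.sub_apply, Matrix.mul_apply, Fin.sum_univ_three]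
  simp [hA 0 0 (by decide), hA 1 1 (by decide), hA 2 2 (by decide), hB 0 0 (by decide),
    hB 1 1 (by decide), hB 2 2 (by decide), hA 2 1 (by decide), hB 2 1 (by decide),
    hA 1 0 (by decide), hB 1 0 (by decide)]

/-- The strictly upper triangular matrix with the given entries above the diagonal. -/
def strictUpperMk (F : Type*) [Field F] {K : Type*} [Field K] [Algebra F K] (a b d : K) :
    strictUpper F 3 K :=
  ⟨!![0, a, d; 0, 0, b; 0, 0, 0], by
    intro i j hij
    fin_cases i <;> fin_cases j <;> first | rfl | exact absurd hij (by decide)⟩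

theorem strictUpper_ext {K : Type*} [Field K] [Algebra F K] {A B : strictUpper F 3 K}
    (h01 : A.1 0 1 = B.1 0 1) (h12 : A.1 1 2 = B.1 1 2) (h02 : A.1 0 2 = B.1 0 2) : A = B := by
  ext i j
  rcases lt_or_ge i j with h | h
  · fin_cases i <;> fin_cases j <;> first | assumption | exact absurd h (by decide)
  · rw [A.2 i j h, B.2 i j h]

variable (F) in
/-- An entry of a strictly upper triangular matrix, as a linear function of the matrix. -/
def strictUpperEntry (K : Type*) [Field K] [Algebra F K] (i j : Fin 3) :
    strictUpper F 3 K →ₗ[F] K :=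
  (Matrix.entryLinearMap F K i j) ∘ₗ (strictUpper F 3 K).toSubmodule.subtype

/-- A class two Lie algebra with abelian centralizers of non-central elements, in which `ad x`
maps the centralizer of every element not commuting with `x` onto `W`, is the algebra of strictly
upper triangular matrices over the field with `|W|` elements. -/
theorem nonempty_equiv_strictUpper [FiniteDimensional F M] [Finite F] {K : Type*} [Field K]
    [Algebra F K] {W : Submodule F M} (hK : Nat.card K = Nat.card W)
    (hW : ∀ w ∈ W, ∀ x : M, ⁅x, w⁆ = 0) (hlie : ∀ x y : M, ⁅x, y⁆ ∈ W)
    (hab : ∀ x ∉ W, ∀ y z : M, ⁅x, y⁆ = 0 → ⁅x, z⁆ = 0 → ⁅y, z⁆ = 0)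
    (hsurj : ∀ x y : M, ⁅x, y⁆ ≠ 0 → ∀ w ∈ W, ∃ u, ⁅y, u⁆ = 0 ∧ ⁅x, u⁆ = w)
    {x y : M} (hxy : ⁅x, y⁆ ≠ 0) : Nonempty (M ≃ₗ⁅F⁆ strictUpper F 3 K) := by
  have : Finite W := Module.finite_of_finite F
  have hW' : ∀ w ∈ W, ∀ x : M, ⁅w, x⁆ = 0 := fun w hw x => lie_eq_zero_comm.1 (hW w hw x)
  have hyx : ⁅y, x⁆ ≠ 0 := mt lie_eq_zero_comm.1 hxy
  have hxW : x ∉ W := fun h => hxy (hW' x h y)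
  have hyW : y ∉ W := fun h => hxy (hW y h x)
  obtain ⟨σ, hσ⟩ := exists_section hlie (hsurj x y hxy)
  obtain ⟨τ, hτ⟩ : ∃ τ : W →ₗ[F] M, ∀ w, ⁅τ w, y⁆ = w ∧ ⁅x, τ w⁆ = 0 := by
    obtain ⟨τ, hτ⟩ := exists_section hlie (hsurj y x hyx)
    -- The sign turns [y,τ w] = w into [τ w,y] = w.
    refine ⟨-τ, fun w => ⟨?_, ?_⟩⟩
    · rw [LinearMap.neg_apply, neg_lie, lie_skew, (hτ w).1]
    · rw [LinearMap.neg_apply, lie_neg, (hτ w).2, neg_zero]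
  have hττ : ∀ a b, ⁅τ a, τ b⁆ = 0 := fun a b => hab x hxW _ _ (hτ a).2 (hτ b).2
  have hσσ : ∀ a b, ⁅σ a, σ b⁆ = 0 := fun a b => hab y hyW _ _ (hσ a).2 (hσ b).2
  have hinf : ∀ v : M, ⁅x, v⁆ = 0 → ⁅v, y⁆ = 0 → v ∈ W := by
    intro v h1 h2
    by_contra hv
    exact hxy (hab v hv x y (lie_eq_zero_comm.1 h1) h2)
  -- Model: x = E₁₂, y = E₂₃, τ a = aE₁₂, σ b = bE₂₃, so the bracket is abE₁₃ and the unit is [x,y]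
  -- = E₁₃.
  let μ : W →ₗ[F] W →ₗ[F] W := LinearMap.mk₂ F (fun a b => ⟨⁅τ a, σ b⁆, hlie _ _⟩)
    (fun a b d => Subtype.ext (by simp)) (fun r a b => Subtype.ext (by simp))
    (fun a b d => Subtype.ext (by simp)) (fun r a b => Subtype.ext (by simp))
  have hμ : ∀ a b, (μ a b : M) = ⁅τ a, σ b⁆ := fun a b => rfl
  let c : W := ⟨⁅x, y⁆, hlie x y⟩
  have one_mul : ∀ a, μ c a = a := by
    intro a
    apply Subtype.ext
    have h : τ c - x ∈ W := hinf _ (by rw [lie_sub, (hτ c).2, lie_self, sub_zero])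
      (by rw [sub_lie, (hτ c).1, sub_self])
    rw [hμ, ← sub_add_cancel (τ c) x, add_lie, hW' _ h, zero_add, (hσ a).1]
  have mul_one : ∀ a, μ a c = a := by
    intro a
    apply Subtype.ext
    have h : σ c - y ∈ W := hinf _ (by rw [lie_sub, (hσ c).1, sub_self])
      (by rw [sub_lie, lie_eq_zero_comm.1 (hσ c).2, lie_self, sub_zero])
    rw [hμ, ← sub_add_cancel (σ c) y, lie_add, hW _ h, zero_add, (hτ a).1]
  have left_comm : ∀ a b d, μ a (μ b d) = μ b (μ a d) := by
    intro a b d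
    have hne : x + σ d ∉ W := by
      intro h
      apply hxy
      rw [← hW' _ h y, add_lie, lie_eq_zero_comm.1 (hσ d).2, add_zero]
    -- All τ a + σ(ad) centralize the noncentral x + σ d, so they commute with each other; expanding
    -- that bracket gives a(bd) = b(ad). Taking d = c yields commutativity, then associativity.
    have h0 : ∀ a, ⁅x + σ d, τ a + σ (μ a d)⁆ = 0 := by
      intro a
      rw [add_lie, lie_add, lie_add, (hτ a).2, (hσ _).1, hσσ, zero_add, add_zero, hμ,
        ← lie_skew (τ a), neg_add_cancel]
    have h1 := hab _ hne _ _ (h0 a) (h0 b)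
    rw [add_lie, lie_add, lie_add, hττ, hσσ, zero_add, add_zero, ← lie_skew (σ _) (τ b), ← hμ,
      ← hμ, ← sub_eq_add_neg, sub_eq_zero] at h1
    exact Subtype.ext h1
  have comm : ∀ a b, μ a b = μ b a := by
    intro a b
    have := left_comm a b c
    rwa [mul_one, mul_one] at this
  have assoc : ∀ a b d, μ (μ a b) d = μ a (μ b d) := by
    intro a b d
    rw [comm (μ a b), left_comm d, comm d]
  have nzd : ∀ a b, μ a b = 0 → a = 0 ∨ b = 0 := by
    intro a b h
    have h' : ⁅τ a, σ b⁆ = 0 := by rw [← hμ, h, Submodule.coe_zero]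
    by_cases ha : τ a ∈ W
    · left
      apply Subtype.ext
      rw [← (hτ a).1, hW' _ ha, Submodule.coe_zero]
    · right
      apply Subtype.ext
      rw [← (hσ b).1, hab _ ha x _ (lie_eq_zero_comm.1 (hτ a).2) h', Submodule.coe_zero]
  obtain ⟨φ, hφ⟩ := exists_linearEquiv_mul μ c (fun h => hxy (congrArg Subtype.val h)) one_mul
    comm assoc nzd hK
  let Φ : strictUpper F 3 K →ₗ[F] M :=
    τ ∘ₗ φ.toLinearMap ∘ₗ strictUpperEntry F K 0 1 +
      σ ∘ₗ φ.toLinearMap ∘ₗ strictUpperEntry F K 1 2 +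
      W.subtype ∘ₗ φ.toLinearMap ∘ₗ strictUpperEntry F K 0 2
  have hΦ : ∀ A, Φ A = τ (φ (A.1 0 1)) + σ (φ (A.1 1 2)) + φ (A.1 0 2) := fun A => rfl
  have hΦx : ∀ A, ⁅x, Φ A⁆ = φ (A.1 1 2) := fun A => by
    rw [hΦ, lie_add, lie_add, (hτ _).2, (hσ _).1, hW _ (φ _).2, zero_add, add_zero]
  have hΦy : ∀ A, ⁅Φ A, y⁆ = φ (A.1 0 1) := fun A => by
    rw [hΦ, add_lie, add_lie, (hτ _).1, lie_eq_zero_comm.1 (hσ _).2, hW' _ (φ _).2, add_zero,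
      add_zero]
  have hΦlie : ∀ A B, Φ ⁅A, B⁆ = ⁅Φ A, Φ B⁆ := by
    intro A B
    obtain ⟨h1, h2, h3⟩ := strictUpper_lie A B
    rw [hΦ, h1, h2, h3, map_zero, map_zero, map_zero, zero_add, zero_add, map_sub, hφ, hφ,
      Submodule.coe_sub, hμ, hμ, hΦ A, hΦ B, lie_add _ _ (φ _ : M), hW _ (φ _).2,
      add_lie _ (φ _ : M), hW' _ (φ _).2, add_lie, lie_add, lie_add, hττ, hσσ,
      ← lie_skew (σ _) (τ _)]
    abel
  have hΦinj : Function.Injective Φ := by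
    intro A B h
    refine strictUpper_ext (φ.injective (Subtype.ext ?_)) (φ.injective (Subtype.ext ?_)) ?_
    · rw [← hΦy, ← hΦy, h]
    · rw [← hΦx, ← hΦx, h]
    · have h12 : A.1 1 2 = B.1 1 2 := φ.injective (Subtype.ext (by rw [← hΦx, ← hΦx, h]))
      have h01 : A.1 0 1 = B.1 0 1 := φ.injective (Subtype.ext (by rw [← hΦy, ← hΦy, h]))
      rw [hΦ, hΦ, h12, h01, add_right_inj] at h
      exact φ.injective (Subtype.ext h)
  have hΦsurj : Function.Surjective Φ := by
    intro v
    let a : W := ⟨⁅v, y⁆, hlie v y⟩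
    let b : W := ⟨⁅x, v⁆, hlie x v⟩
    have h : v - τ a - σ b ∈ W := by
      refine hinf _ ?_ ?_
      · rw [lie_sub, lie_sub, (hτ a).2, (hσ b).1, sub_zero, sub_self]
      · rw [sub_lie, sub_lie, (hτ a).1, lie_eq_zero_comm.1 (hσ b).2, sub_self, sub_zero]
    refine ⟨strictUpperMk F (φ.symm a) (φ.symm b) (φ.symm ⟨_, h⟩), ?_⟩
    change τ (φ (φ.symm a)) + σ (φ (φ.symm b)) + ((φ (φ.symm ⟨_, h⟩) : W) : M) = v
    rw [φ.apply_symm_apply, φ.apply_symm_apply, φ.apply_symm_apply]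
    change τ a + σ b + (v - τ a - σ b) = v
    rw [sub_sub, add_sub_cancel]
  let e : strictUpper F 3 K ≃ₗ[F] M := LinearEquiv.ofBijective Φ ⟨hΦinj, hΦsurj⟩
  let f : strictUpper F 3 K ≃ₗ⁅F⁆ M := { e with map_lie' := fun {A B} => hΦlie A B }
  exact ⟨f.symm⟩

end Coordinates

/-! ### Nilpotency class and passage to L/Z -/

section Quotient

variable {F L : Type*} [Field F] [LieRing L] [LieAlgebra F L]

theorem lie_lie_lie_eq_zero_of_isStepNilpotent (F : Type*) [Field F] [LieAlgebra F L]
    (h : IsStepNilpotent L 3) (w x y z : L) : ⁅w, ⁅x, ⁅y, z⁆⁆⁆ = 0 := by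
  have h1 := ((LieModule.nilpotencyLength_eq_succ_iff F L L 2).1 h.2).1
  rw [← LieSubmodule.mem_bot (R := F) (L := L), ← h1]
  simp only [LieModule.lowerCentralSeries_succ, LieModule.lowerCentralSeries_zero]
  exact LieSubmodule.lie_mem_lie trivial (LieSubmodule.lie_mem_lie trivial
    (LieSubmodule.lie_mem_lie trivial trivial))

theorem exists_lie_notMem_center (F : Type*) [Field F] [LieAlgebra F L]
    (h : IsStepNilpotent L 3) : ∃ x y : L, ⁅x, y⁆ ∉ center F L := by
  have h1 := ((LieModule.nilpotencyLength_eq_succ_iff F L L 2).1 h.2).2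
  by_contra! h2
  apply h1
  simp only [LieModule.lowerCentralSeries_succ, LieModule.lowerCentralSeries_zero]
  rw [eq_bot_iff, LieSubmodule.lie_le_iff]
  intro x _ a ha
  have h4 : a ∈ center F L := derived_induction (p := (center F L).toSubmodule) h2 ha
  rw [mem_center_iff.1 h4]
  exact zero_mem _

theorem isStepNilpotent_two_of_lie_lie_eq_zero {M : Type*} (F : Type*) [Field F] [LieRing M]
    [LieAlgebra F M] (h : ∀ x y z : M, ⁅x, ⁅y, z⁆⁆ = 0) {x y : M} (hxy : ⁅x, y⁆ ≠ 0) :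
    IsStepNilpotent M 2 := by
  have h2 : LieModule.lowerCentralSeries F M M 2 = ⊥ := by
    simp only [LieModule.lowerCentralSeries_succ, LieModule.lowerCentralSeries_zero]
    rw [eq_bot_iff, LieSubmodule.lie_le_iff]
    intro x _ a ha
    have h4 : a ∈ center F M := derived_induction (p := (center F M).toSubmodule)
      (fun y z => mem_center_iff.2 fun x => h x y z) ha
    rw [mem_center_iff.1 h4]
    exact zero_mem _
  refine ⟨LieModule.IsNilpotent.mk M h2,
    (LieModule.nilpotencyLength_eq_succ_iff F M M 1).2 ⟨h2, fun h1 => hxy ?_⟩⟩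
  rw [← LieSubmodule.mem_bot (R := F) (L := M), ← h1]
  simp only [LieModule.lowerCentralSeries_succ, LieModule.lowerCentralSeries_zero]
  exact LieSubmodule.lie_mem_lie trivial trivial

variable (F) in
/-- The projection onto the quotient by the centre. -/
abbrev π (x : L) : L ⧸ center F L := LieSubmodule.Quotient.mk x

theorem π_eq_zero {x : L} : π F x = 0 ↔ x ∈ center F L := LieSubmodule.Quotient.mk_eq_zero'

theorem lie_π (x y : L) : ⁅π F x, π F y⁆ = π F ⁅x, y⁆ := rfl

theorem lie_π_eq_zero {x y : L} : ⁅π F x, π F y⁆ = 0 ↔ ⁅x, y⁆ ∈ center F L := by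
  rw [lie_π, π_eq_zero]

theorem π_surjective : Function.Surjective (π F : L → L ⧸ center F L) :=
  LieSubmodule.Quotient.surjective_mk' _

theorem π_mem_center {x : L} : π F x ∈ center F (L ⧸ center F L) ↔ x ∈ center₂ F L := by
  rw [mem_center_iff, mem_center₂, π_surjective.forall]
  exact forall_congr' fun y => lie_π_eq_zero

/-- Stemness makes D a union of cosets of Z, so membership can be tested in the quotient. -/
theorem π_mem_derived (hstem : IsStem F L) {x : L} :
    π F x ∈ derived F (L ⧸ center F L) ↔ x ∈ derived F L := by
  constructor
  · have h : (derived F (L ⧸ center F L)).toSubmodule ≤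
        (derived F L).toSubmodule.map (center F L).toSubmodule.mkQ := by
      refine derived_induction fun u v => ?_
      obtain ⟨u, rfl⟩ := π_surjective u
      obtain ⟨v, rfl⟩ := π_surjective v
      exact ⟨⁅u, v⁆, lie_mem_derived u v, (lie_π u v).symm⟩
    intro hx
    obtain ⟨a, ha, hax⟩ := h hx
    have h1 := hstem ((Submodule.Quotient.eq _).1 hax)
    have h2 := sub_mem ha h1
    rwa [sub_sub_cancel] at h2
  · have h : (derived F L).toSubmodule ≤ (derived F (L ⧸ center F L)).toSubmodule.comap
        (center F L).toSubmodule.mkQ :=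
      derived_induction fun u v => (lie_mem_derived (F := F) (π F u) (π F v) : _)
    exact fun hx => h hx

end Quotient

end NilLie

/-! ### Assembly of the main theorem -/

open NilLie Module LieAlgebra in
theorem mainTheorem4 {F : Type*} [Field F] [Finite F] (q : ℕ) (hq : Nat.card F = q)
    {L : Type*} [LieRing L] [LieAlgebra F L] [FiniteDimensional F L]
    (m : ℕ) (hm : 1 ≤ m)
    (hnil : NilLie.IsStepNilpotent L 3)
    (hstem : NilLie.IsStem F L)
    (hbreadth : NilLie.HasBreadthType F L [0, 2 * m])
    {K : Type*} [Field K] [Algebra F K] (hK : Nat.card K = q ^ m) :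
    Nonempty ((L ⧸ LieAlgebra.center F L) ≃ₗ⁅F⁆ NilLie.strictUpper F 3 K) ∧
    NilLie.IsStepNilpotent (L ⧸ LieAlgebra.center F L) 2 ∧
    NilLie.IsCamina F (L ⧸ LieAlgebra.center F L) ∧
    Module.finrank F (L ⧸ LieAlgebra.center F L) = 3 * m ∧
    ∀ x : L ⧸ LieAlgebra.center F L, x ∉ LieAlgebra.center F (L ⧸ LieAlgebra.center F L) →
      IsLieAbelian (NilLie.centralizer F (L ⧸ LieAlgebra.center F L) x) := by
  have h3 := lie_lie_lie_eq_zero_of_isStepNilpotent F hnil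
  have hb : ∀ x : L, x ∉ center F L → finrank F (cent F x) + 2 * m = finrank F L := by
    intro x hx
    have h1 : breadth F L x + finrank F (cent F x) = finrank F L :=
      (cent F x).finrank_quotient_add_finrank
    have h2 : breadth F L x ∈ [0, 2 * m] := (hbreadth.2 _).2 ⟨x, rfl⟩
    have h4 : breadth F L x ≠ 0 := by
      intro h
      apply hx
      have h5 : cent F x = ⊤ := Submodule.eq_top_of_finrank_eq (by omega)
      exact mem_center_iff'.2 fun y => mem_cent.1 (h5.ge (Submodule.mem_top (x := y)))
    have h5 : breadth F L x = 2 * m := by simpa [h4] using h2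
    omega
  have hs : ∀ x : L, x ∉ center F L → finrank F (cent F x) = finrank F L - 2 * m := by
    intro x hx
    have := hb x hx
    omega
  obtain ⟨x₀, y₀, hxy⟩ := exists_lie_notMem_center F hnil
  have hx₀ : x₀ ∉ center₂ F L := fun h => hxy (mem_center₂'.1 h y₀)
  have h2 := center₂_eq_derived h3 hs hstem hxy
  have hdim := (finrank_centMod h3 hs hstem hx₀).2
  have hdimC := hb _ hxy
  rw [cent_lie_eq_center₂ h3 hs hxy, h2] at hdimC
  rw [h2] at hdim
  change _ = finrank F (derived F L) + _ at hdim
  change finrank F (derived F L) + _ = _ at hdimC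
  have hdimQ := (center F L).toSubmodule.finrank_quotient_add_finrank
  change finrank F (L ⧸ center F L) + finrank F (center F L) = _ at hdimQ
  -- `hdimC` reads dim D + 2m = dim L and `hdim` reads dim L + 2 dim Z = 3 dim D, so dim D − dim Z =
  -- m.
  have hQ : finrank F (L ⧸ center F L) = 3 * m := by omega
  have hcd : ∀ x : L ⧸ center F L,
      x ∈ center F (L ⧸ center F L) ↔ x ∈ derived F (L ⧸ center F L) := by
    intro x
    obtain ⟨x, rfl⟩ := π_surjective x
    rw [π_mem_center, π_mem_derived hstem, h2]
    rfl
  have hab : ∀ x : L ⧸ center F L, x ∉ center F (L ⧸ center F L) →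
      ∀ y z : L ⧸ center F L, ⁅x, y⁆ = 0 → ⁅x, z⁆ = 0 → ⁅y, z⁆ = 0 := by
    intro x hx y z hy hz
    obtain ⟨x, rfl⟩ := π_surjective x
    obtain ⟨y, rfl⟩ := π_surjective y
    obtain ⟨z, rfl⟩ := π_surjective z
    rw [lie_π_eq_zero] at *
    exact lie_mem_center_of_mem_centMod h3 hs (mt π_mem_center.2 hx) hy hz
  have hlie : ∀ x y : L ⧸ center F L, ⁅x, y⁆ ∈ center F (L ⧸ center F L) :=
    fun x y => (hcd _).2 (lie_mem_derived x y)
  have hne : ⁅π F x₀, π F y₀⁆ ≠ 0 := mt lie_π_eq_zero.1 hxy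
  have hcard : Nat.card K = Nat.card (center F (L ⧸ center F L)).toSubmodule := by
    have h4 : (center F (L ⧸ center F L)).toSubmodule =
        (derived F L).toSubmodule.map (center F L).toSubmodule.mkQ := by
      ext x
      obtain ⟨x, rfl⟩ := π_surjective x
      constructor
      · intro h
        exact ⟨x, (π_mem_derived hstem).1 ((hcd _).1 h), rfl⟩
      · rintro ⟨a, ha, hax⟩
        rw [← hax]
        exact (hcd _).2 ((π_mem_derived hstem).2 ha)
    have h5 := finrank_map_mkQ_derived hstem
    rw [← h4] at h5
    change finrank F (center F (L ⧸ center F L)).toSubmodule + finrank F (center F L) =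
      finrank F (derived F L) at h5
    rw [hK, Module.natCard_eq_pow_finrank (K := F), hq]
    congr 1
    omega
  refine ⟨nonempty_equiv_strictUpper hcard (fun w hw => mem_center_iff.1 hw) hlie hab ?_ hne,
    isStepNilpotent_two_of_lie_lie_eq_zero F (fun x y z => mem_center_iff.1 (hlie y z) x) hne,
    ?_, hQ, fun x hx => ⟨fun y z => Subtype.ext (hab x hx y z y.2 z.2)⟩⟩
  · intro x y hxy w hw
    obtain ⟨x, rfl⟩ := π_surjective x
    obtain ⟨y, rfl⟩ := π_surjective y
    obtain ⟨w, rfl⟩ := π_surjective w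
    obtain ⟨u, hu, huw⟩ := exists_mem_centMod_lie_sub_mem_center h3 hs hstem
      (mt lie_π_eq_zero.2 hxy) ((π_mem_derived hstem).1 ((hcd _).1 hw))
    refine ⟨π F u, lie_π_eq_zero.2 hu, ?_⟩
    rw [lie_π]
    exact (Submodule.Quotient.eq _).2 huw
  · intro x hx
    obtain ⟨x, rfl⟩ := π_surjective x
    rw [← hcd, π_mem_center] at hx
    refine Set.Subset.antisymm ?_ fun w hw => ?_
    · rintro _ ⟨y, rfl⟩
      exact lie_mem_derived _ _
    · obtain ⟨w, rfl⟩ := π_surjective w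
      obtain ⟨l, hl⟩ := exists_lie_sub_mem_center h3 hs hstem hx ((π_mem_derived hstem).1 hw)
      refine ⟨π F l, ?_⟩
      rw [lie_π]
      exact (Submodule.Quotient.eq _).2 hl
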